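/- Let $\Omega\subset\mathbb R^n$ be a bounded open set with Lipschitz boundary $\Sigma=\partial\Omega$, and let $\beta\in L^\infty(\Sigma)$. For $u,v\in L^1(\Omega)$ define $$\int_\Omega\sqrt{1+|Du|^2}:=\sup_{g}\int_\Omega \big(g_{n+1}+u\,\mathrm{div}_n g\big)\,dx,\qquad \int_\Omega\sqrt{v^2+|Dv|^2}:=\sup_{g}\int_\Omega v\,\big(g_{n+1}+\mathrm{div}_n g\big)\,dx,$$ where both suprema run over all $g=(g_1,\dots,g_{n+1})$ with $g_i\in C^1(\Omega)$ compactly supported in $\Omega$ and $\sum_{i=1}^{n+1}g_i^2\le 1$, and $\mathrm{div}_n g=\sum_{i=1}^n D_ig_i$. Let $BV(\Omega)=\{u\in L^1(\Omega):\int_\Omega\sqrt{1+|Du|^2}<\infty\}$ and $BV^+(\Omega)=\{u\in BV(\Omega): u\ge0 \text{ a.e. in }\Omega\}$. For $v\in BV^+(\Omega)$ let $$\mathcal J_1(v)=\int_\Omega\sqrt{v^2+|Dv|^2}+\int_\Omega\int_1^{v}\ln h\,dh\,dx-\int_\Sigma\beta\,(1-v)\,ds,$$ where $v$ on $\Sigma$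 is the trace of $v$, that is, for $\mathcal H^{n-1}$-almost every $x\in\Sigma$ the limit as $r\downarrow0$ of the mean value of $v$ over $B_r(x)\cap\Omega$, and $ds$ is surface measure. Suppose that $\beta\ge0$ almost everywhere on $\Sigma$ and that $v\in BV^+(\Omega)$ minimises $\mathcal J_1$ in $BV^+(\Omega)$, i.e. $\mathcal J_1(v)\le\mathcal J_1(w)$ for all $w\in BV^+(\Omega)$. Then $v$ is (essentially) bounded from above: there is $K\in\mathbb R$ with $v\le K$ almost everywhere in $\Omega$. -/

import Mathlib

open MeasureTheory Filter Topology

noncomputable section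

namespace Capillary

/-- Euclidean space `ℝⁿ`. -/
abbrev E (n : ℕ) := EuclideanSpace ℝ (Fin n)

/-- `Ω` has Lipschitz boundary: near every boundary point, in a suitable direction `ν`,
the set `Ω` is the strict epigraph of a Lipschitz function of the coordinates orthogonal to `ν`. -/
def HasLipschitzBoundary {n : ℕ} (Ω : Set (E n)) : Prop :=
  ∀ x₀ ∈ frontier Ω, ∃ (ν : E n) (r : ℝ) (L : NNReal) (φ : (ℝ ∙ ν)ᗮ → ℝ),
    ‖ν‖ = 1 ∧ 0 < r ∧ LipschitzWith L φ ∧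
    ∀ x ∈ Metric.ball x₀ r, x ∈ Ω ↔ φ ((ℝ ∙ ν)ᗮ.orthogonalProjectionOnto x) < inner ℝ ν x

/-- The divergence of a vector field on `ℝⁿ`. -/
def divergence {n : ℕ} (g : E n → E n) (x : E n) : ℝ :=
  ∑ i : Fin n, (fderiv ℝ g x (EuclideanSpace.single i 1)) i

/-- Admissible test fields `(g, g₀) = (g₁, …, gₙ, gₙ₊₁)`: of class `C¹`, compactly supported in `Ω`,
with `g₁² + ⋯ + gₙ² + gₙ₊₁² ≤ 1`. -/
structure IsTestField {n : ℕ} (Ω : Set (E n)) (g : E n → E n) (g₀ : E n → ℝ) : Prop where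
  contDiff : ContDiff ℝ 1 g
  contDiff_last : ContDiff ℝ 1 g₀
  hasCompactSupport : HasCompactSupport g
  hasCompactSupport_last : HasCompactSupport g₀
  tsupport_subset : tsupport g ⊆ Ω
  tsupport_last_subset : tsupport g₀ ⊆ Ω
  sq_add_sq_le_one : ∀ x, ‖g x‖ ^ 2 + g₀ x ^ 2 ≤ 1

/-- `∫_Ω √(1 + |Du|²)`, the area of the graph of `u`, for `u` integrable on `Ω`. -/
def graphArea {n : ℕ} (Ω : Set (E n)) (u : E n → ℝ) : EReal :=
  ⨆ (g : E n → E n) (g₀ : E n → ℝ) (_ : IsTestField Ω g g₀),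
    ((∫ x in Ω, (g₀ x + u x * divergence g x) : ℝ) : EReal)

/-- `∫_Ω √(v² + |Dv|²)`, the weighted area, for `v` integrable on `Ω`. -/
def weightedArea {n : ℕ} (Ω : Set (E n)) (v : E n → ℝ) : EReal :=
  ⨆ (g : E n → E n) (g₀ : E n → ℝ) (_ : IsTestField Ω g g₀),
    ((∫ x in Ω, v x * (g₀ x + divergence g x) : ℝ) : EReal)

/-- `BV(Ω)`; its elements are represented by functions on `ℝⁿ`, of which only the
almost everywhere class on `Ω` matters. -/
def BV {n : ℕ} (Ω : Set (E n)) : Set (E n → ℝ) :=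
  {u | IntegrableOn u Ω ∧ graphArea Ω u < ⊤}

/-- `BV⁺(Ω)`, the almost everywhere non-negative elements of `BV(Ω)`. -/
def BVPlus {n : ℕ} (Ω : Set (E n)) : Set (E n → ℝ) :=
  {u | u ∈ BV Ω ∧ ∀ᵐ x ∂(volume.restrict Ω), 0 ≤ u x}

/-- The trace of `v` at a boundary point `x`: the limit as `r ↓ 0` of the mean values of `v` over
`B_r(x) ∩ Ω`. For `v ∈ BV(Ω)` and `Ω` bounded with Lipschitz boundary this limit exists
at `ℋⁿ⁻¹`-almost every boundary point; it is written as an upper limit in order to have a value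
at the remaining points as well. -/
def trace {n : ℕ} (Ω : Set (E n)) (v : E n → ℝ) (x : E n) : EReal :=
  limsup (fun r : ℝ => ((⨍ y in Metric.ball x r ∩ Ω, v y : ℝ) : EReal)) (𝓝[>] 0)

/-- The Lebesgue integral `∫ f⁺ - ∫ f⁻` of an extended real valued function. -/
def extIntegral {α : Type*} [MeasurableSpace α] (μ : Measure α) (f : α → EReal) : EReal :=
  ((∫⁻ x, (f x).toENNReal ∂μ : ENNReal) : EReal) - ((∫⁻ x, (-f x).toENNReal ∂μ : ENNReal) : EReal)

/-- The surface measure on `Σ = ∂Ω`: the `(n-1)`-dimensional Hausdorff measure in its Euclidean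
normalisation. -/
def surfaceMeasure {n : ℕ} (Ω : Set (E n)) : Measure (E n) :=
  (Measure.euclideanHausdorffMeasure (n - 1)).restrict (frontier Ω)

/-- The potential energy `∫_Ω ∫_1^v ln h dh dx`. -/
def potentialEnergy {n : ℕ} (Ω : Set (E n)) (v : E n → ℝ) : EReal :=
  extIntegral (volume.restrict Ω) (fun x => ((∫ h in (1 : ℝ)..(v x), Real.log h : ℝ) : EReal))

/-- The boundary integral `∫_Σ β (1 - v) ds`, where `v` on `Σ` is the trace. -/
def wettingIntegral {n : ℕ} (Ω : Set (E n)) (β v : E n → ℝ) : EReal :=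
  extIntegral (surfaceMeasure Ω) (fun x => (β x : EReal) * (1 - trace Ω v x))

/-- The energy `𝒥₁(v) = ∫_Ω √(v² + |Dv|²) + ∫_Ω ∫_1^v ln h dh dx - ∫_Σ β (1 - v) ds`. -/
def J₁ {n : ℕ} (Ω : Set (E n)) (β v : E n → ℝ) : EReal :=
  weightedArea Ω v + potentialEnergy Ω v - wettingIntegral Ω β v

end Capillary

end

/-! Compare `v` with `w = T(v)`, where `T` is a smooth, bounded, nondecreasing stand-in for `min ·
1`, with `T t ≤ t`. None of the three terms of `J₁` increases. The wetting term behaves because `β ≥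
0` and traces are monotone. The potential term behaves because its density `t ln t - t + 1` is
strictly increasing on `[1, ∞)` and `T t = t` for `t ≤ 1`. Minimality then forces the potential
energies to agree, hence `T(v) = v` almost everywhere where `v > 1`; since `T ≤ 2`, this gives `v ≤
2`.

The area term is the real work (`weightedArea_truncation_le`). For `u` of class `C¹`, testing `T(u)`
with `(g, g₀)` is the same as testing `u` with `(T'(u) g, (T(u)/u) g₀)`, which is again admissible
as both factors lie in `[0, 1]` for `u ≥ 0` (`IsTestField.integral_truncation`). Smoothness of `T`
keeps the new field `C¹`. Mollification carries the inequality over to `v`.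

Cancelling the other terms requires finite energies: the competitor `0` bounds `J₁ Ω β v`, and the
wetting integral is bounded above because `β` is bounded and the boundary has finite surface
measure. -/

open scoped Convolution

/-! ### The smooth truncation of the real line. -/

/-- The derivative of `truncation`: a smooth function equal to `1` on `(-∞, 1]` and to `0` on `[2, ∞)`. -/
noncomputable def truncationSlope (t : ℝ) : ℝ := 1 - Real.smoothTransition (t - 1)

/-- A smooth bounded replacement of `min · 1`. -/
noncomputable def truncation (t : ℝ) : ℝ := ∫ s in (0 : ℝ)..t, truncationSlope s

/-- The quotient `truncation t / t`, extended by `1` to the non-positive numbers. -/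
noncomputable def truncationRatio (t : ℝ) : ℝ := if t ≤ 1 then 1 else truncation t / t

lemma truncationSlope_contDiff : ContDiff ℝ 1 truncationSlope :=
  contDiff_const.sub (Real.smoothTransition.contDiff.comp (contDiff_id.sub contDiff_const))

lemma truncationSlope_nonneg (t : ℝ) : 0 ≤ truncationSlope t :=
  sub_nonneg.2 (Real.smoothTransition.le_one _)

lemma truncationSlope_le_one (t : ℝ) : truncationSlope t ≤ 1 :=
  sub_le_self _ (Real.smoothTransition.nonneg _)

lemma truncationSlope_eq_one {t : ℝ} (ht : t ≤ 1) : truncationSlope t = 1 := by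
  simp [truncationSlope, Real.smoothTransition.zero_of_nonpos (sub_nonpos.2 ht)]

lemma truncationSlope_eq_zero {t : ℝ} (ht : 2 ≤ t) : truncationSlope t = 0 := by
  simp [truncationSlope, Real.smoothTransition.one_of_one_le (by linarith : 1 ≤ t - 1)]

lemma truncation_hasDerivAt (t : ℝ) : HasDerivAt truncation (truncationSlope t) t :=
  truncationSlope_contDiff.continuous.integral_hasStrictDerivAt 0 t |>.hasDerivAt

lemma truncation_contDiff : ContDiff ℝ 1 truncation := by
  rw [contDiff_one_iff_deriv]
  refine ⟨fun t => (truncation_hasDerivAt t).differentiableAt, ?_⟩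
  rw [funext fun t => (truncation_hasDerivAt t).deriv]
  exact truncationSlope_contDiff.continuous

lemma truncation_of_le_one {t : ℝ} (ht : t ≤ 1) : truncation t = t := by
  have : truncation t = ∫ _ in (0 : ℝ)..t, (1 : ℝ) := by
    refine intervalIntegral.integral_congr fun s hs => truncationSlope_eq_one ?_
    exact hs.2.trans (max_le zero_le_one ht)
  simpa using this

lemma truncation_monotone : Monotone truncation :=
  monotone_of_deriv_nonneg (fun t => (truncation_hasDerivAt t).differentiableAt) fun t => by
    rw [(truncation_hasDerivAt t).deriv]; exact truncationSlope_nonneg t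

lemma truncation_nonneg {t : ℝ} (ht : 0 ≤ t) : 0 ≤ truncation t := by
  simpa [truncation_of_le_one zero_le_one] using truncation_monotone ht

lemma one_le_truncation {t : ℝ} (ht : 1 ≤ t) : 1 ≤ truncation t := by
  simpa [truncation_of_le_one le_rfl] using truncation_monotone ht

lemma sub_truncation_monotone : Monotone fun t => t - truncation t :=
  monotone_of_deriv_nonneg
    (fun t => ((hasDerivAt_id t).sub (truncation_hasDerivAt t)).differentiableAt) fun t => by
    have := ((hasDerivAt_id t).sub (truncation_hasDerivAt t)).deriv
    simp only [Pi.sub_def, id] at this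
    rw [this]; exact sub_nonneg.2 (truncationSlope_le_one t)

lemma truncation_le_self (t : ℝ) : truncation t ≤ t := by
  rcases le_total t 1 with ht | ht
  · exact (truncation_of_le_one ht).le
  · simpa [truncation_of_le_one le_rfl] using sub_truncation_monotone ht

lemma truncation_le_two (t : ℝ) : truncation t ≤ 2 := by
  rcases le_total t 2 with ht | ht
  · exact (truncation_le_self t).trans ht
  · have : truncation t = truncation 2 := by
      rw [← sub_eq_zero, truncation, truncation, intervalIntegral.integral_interval_sub_left
        (truncationSlope_contDiff.continuous.intervalIntegrable _ _)
        (truncationSlope_contDiff.continuous.intervalIntegrable _ _),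
        intervalIntegral.integral_congr (g := fun _ => (0 : ℝ))]
      · simp
      · intro s hs
        rw [Set.uIcc_of_le ht] at hs
        exact truncationSlope_eq_zero hs.1
    rw [this]; exact truncation_le_self 2

lemma mul_truncationRatio (t : ℝ) : t * truncationRatio t = truncation t := by
  unfold truncationRatio
  split_ifs with h
  · rw [mul_one, truncation_of_le_one h]
  · have : t ≠ 0 := by linarith
    field_simp

/-- Since `truncation` is the identity up to `1`, the two branches agree on `(0, 1]`, so there is no
kink at `1`. -/
lemma truncationRatio_contDiff : ContDiff ℝ 1 truncationRatio := by
  rw [contDiff_iff_contDiffAt]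
  intro t
  rcases lt_or_ge t 1 with ht | ht
  · refine (contDiffAt_const (c := (1 : ℝ))).congr_of_eventuallyEq ?_
    filter_upwards [Iio_mem_nhds ht] with s hs
    exact if_pos (le_of_lt hs)
  · have h0 : 0 < t := by linarith
    refine (truncation_contDiff.contDiffAt.div contDiffAt_id h0.ne').congr_of_eventuallyEq ?_
    filter_upwards [Ioi_mem_nhds h0] with s hs
    have hs' : s ≠ 0 := ne_of_gt hs
    rw [Pi.div_apply, ← mul_truncationRatio s, id, mul_div_cancel_left₀ _ hs']

lemma abs_truncationRatio_le_one (t : ℝ) : |truncationRatio t| ≤ 1 := by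
  unfold truncationRatio
  split_ifs with h
  · simp
  · have : 0 < t := by linarith
    rw [abs_of_nonneg (div_nonneg (truncation_nonneg this.le) this.le)]
    exact div_le_one_of_le₀ (truncation_le_self t) this.le

lemma truncation_lt_self {t : ℝ} (ht : 2 < t) : truncation t < t :=
  (truncation_le_two t).trans_lt ht

/-! ### Divergence and the calculus of test fields. -/

namespace Capillary

variable {n : ℕ}

lemma divergence_smul {f : E n → ℝ} {g : E n → E n} {x : E n} (hf : DifferentiableAt ℝ f x)
    (hg : DifferentiableAt ℝ g x) :
    divergence (fun y => f y • g y) x =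
      f x * divergence g x + ∑ i, fderiv ℝ f x (EuclideanSpace.single i 1) * g x i := by
  simp only [divergence, Finset.mul_sum, ← Finset.sum_add_distrib]
  refine Finset.sum_congr rfl fun i _ => ?_
  rw [fderiv_fun_smul hf hg]
  simp

lemma divergence_comp_add (g : E n → E n) (t x : E n) :
    divergence (fun y => g (y + t)) x = divergence g (x + t) := by
  simp [divergence, fderiv_comp_add_right]

lemma continuous_divergence {g : E n → E n} (hg : ContDiff ℝ 1 g) : Continuous (divergence g) := by
  unfold divergence
  have := hg.continuous_fderiv one_ne_zero
  fun_prop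

lemma divergence_eq_zero_of_notMem_tsupport {g : E n → E n} {x : E n} (hx : x ∉ tsupport g) :
    divergence g x = 0 := by
  have : fderiv ℝ g x = 0 := image_eq_zero_of_notMem_tsupport
    fun h => hx (tsupport_fderiv_subset ℝ h)
  simp [divergence, this]

lemma hasCompactSupport_divergence {g : E n → E n} (hg : HasCompactSupport g) :
    HasCompactSupport (divergence g) :=
  HasCompactSupport.intro hg fun _ => divergence_eq_zero_of_notMem_tsupport

lemma integral_divergence_eq_zero {g : E n → E n} (hg : ContDiff ℝ 1 g)
    (hc : HasCompactSupport g) : ∫ x, divergence g x = 0 := by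
  have hd : ∀ i, ContDiff ℝ 1 fun x => g x i := fun i => by fun_prop
  have hci : ∀ i, HasCompactSupport fun x => g x i := fun i =>
    hc.comp_left (g := fun y : E n => y i) rfl
  have key : ∀ x i, (fderiv ℝ g x (EuclideanSpace.single i 1)) i =
      fderiv ℝ (fun y => g y i) x (EuclideanSpace.single i 1) := by
    intro x i
    have h := ((EuclideanSpace.proj i : E n →L[ℝ] ℝ).hasFDerivAt.comp x
      (hg.differentiable one_ne_zero x).hasFDerivAt).fderiv
    have h' : (fun y => g y i) = (EuclideanSpace.proj i : E n →L[ℝ] ℝ) ∘ g := by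
      ext; simp
    rw [h', h]; simp
  have hint : ∀ i, Integrable fun x => fderiv ℝ (fun y => g y i) x (EuclideanSpace.single i 1) :=
    fun i => Continuous.integrable_of_hasCompactSupport
      (((hd i).continuous_fderiv one_ne_zero).clm_apply continuous_const)
      ((hci i).fderiv_apply ℝ _)
  simp only [divergence, key]
  rw [integral_finsetSum _ fun i _ => hint i]
  refine Finset.sum_eq_zero fun i _ => ?_
  -- Integration by parts against the constant function `1`.
  have := integral_mul_fderiv_eq_neg_fderiv_mul_of_integrable (μ := volume) (f := fun _ : E n => (1 : ℝ))
    (g := fun y => g y i) (v := EuclideanSpace.single i 1) (by simp) (by simpa using hint i)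
    (by simpa using (hd i).continuous.integrable_of_hasCompactSupport (hci i)) (by simp)
    (fun x _ => (hd i).differentiable one_ne_zero x)
  simpa using this

namespace IsTestField

variable {Ω : Set (E n)} {g : E n → E n} {g₀ : E n → ℝ}

lemma continuous_add (h : IsTestField Ω g g₀) : Continuous fun x => g₀ x + divergence g x :=
  h.contDiff_last.continuous.add (continuous_divergence h.contDiff)

lemma hasCompactSupport_add (h : IsTestField Ω g g₀) :
    HasCompactSupport fun x => g₀ x + divergence g x :=
  h.hasCompactSupport_last.add (hasCompactSupport_divergence h.hasCompactSupport)

lemma exists_bound (h : IsTestField Ω g g₀) : ∃ C, ∀ x, ‖g₀ x + divergence g x‖ ≤ C :=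
  h.hasCompactSupport_add.exists_bound_of_continuous h.continuous_add

lemma add_eq_zero_of_notMem (h : IsTestField Ω g g₀) {x : E n} (hx : x ∉ Ω) :
    g₀ x + divergence g x = 0 := by
  rw [image_eq_zero_of_notMem_tsupport fun h' => hx (h.tsupport_last_subset h'),
    divergence_eq_zero_of_notMem_tsupport fun h' => hx (h.tsupport_subset h'), add_zero]

lemma setIntegral_eq_integral (h : IsTestField Ω g g₀) (v : E n → ℝ) :
    ∫ x in Ω, v x * (g₀ x + divergence g x) = ∫ x, v x * (g₀ x + divergence g x) :=
  setIntegral_eq_integral_of_forall_compl_eq_zero fun x hx => by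
    rw [h.add_eq_zero_of_notMem hx, mul_zero]

lemma comp_add (h : IsTestField Ω g g₀) {r : ℝ} {Ω' : Set (E n)} {t : E n}
    (ht : t ∈ Metric.ball 0 r) (hg : Metric.cthickening r (tsupport g) ⊆ Ω')
    (hg₀ : Metric.cthickening r (tsupport g₀) ⊆ Ω') :
    IsTestField Ω' (fun x => g (x + t)) (fun x => g₀ (x + t)) := by
  have key : ∀ s : Set (E n), (fun x => x + t) ⁻¹' s ⊆ Metric.cthickening r s := fun s x hx =>
    Metric.mem_cthickening_of_dist_le x (x + t) r s hx (by
      simpa [dist_eq_norm] using (mem_ball_zero_iff.1 ht).le)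
  refine ⟨h.contDiff.comp (by fun_prop), h.contDiff_last.comp (by fun_prop),
    h.hasCompactSupport.comp_homeomorph (Homeomorph.addRight t),
    h.hasCompactSupport_last.comp_homeomorph (Homeomorph.addRight t),
    ?_, ?_, fun x => h.sq_add_sq_le_one _⟩
  · exact ((tsupport_comp_subset_preimage g (continuous_add_const t)).trans (key _)).trans hg
  · exact ((tsupport_comp_subset_preimage g₀ (continuous_add_const t)).trans (key _)).trans hg₀

/-- Testing the truncation of `u` amounts to testing `u` itself with another field. -/
lemma truncation_smul (h : IsTestField Ω g g₀) {u : E n → ℝ} (hu : ContDiff ℝ 1 u) :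
    IsTestField Ω (fun x => truncationSlope (u x) • g x) (fun x => truncationRatio (u x) * g₀ x) := by
  have hS : ContDiff ℝ 1 fun x => truncationSlope (u x) := truncationSlope_contDiff.comp hu
  have hR : ContDiff ℝ 1 fun x => truncationRatio (u x) := truncationRatio_contDiff.comp hu
  have sg : Function.support (fun x => truncationSlope (u x) • g x) ⊆ Function.support g :=
    fun x hx h0 => hx (by simp only [h0, smul_zero])
  have sg₀ : Function.support (fun x => truncationRatio (u x) * g₀ x) ⊆ Function.support g₀ :=
    fun x hx h0 => hx (by simp only [h0, mul_zero])
  refine ⟨hS.fun_smul h.contDiff, hR.mul h.contDiff_last, h.hasCompactSupport.mono sg,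
    h.hasCompactSupport_last.mono sg₀, (closure_mono sg).trans h.tsupport_subset,
    (closure_mono sg₀).trans h.tsupport_last_subset, fun x => ?_⟩
  have h1 : truncationSlope (u x) ^ 2 ≤ 1 :=
    pow_le_one₀ (truncationSlope_nonneg _) (truncationSlope_le_one _)
  have h2 : truncationRatio (u x) ^ 2 ≤ 1 := (sq_le_one_iff_abs_le_one _).2 (abs_truncationRatio_le_one _)
  have h3 := h.sq_add_sq_le_one x
  rw [norm_smul, mul_pow, mul_pow, Real.norm_eq_abs, sq_abs]
  nlinarith [sq_nonneg ‖g x‖, sq_nonneg (g₀ x)]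

/-- With `T = truncation`, `S = T'` and `a(t) = T(t) - t S(t)`, one has `a'(t) = -t S'(t)`, so `T(u)
div g = u div(S(u) g) + div(a(u) g)`; the last divergence integrates to zero. -/
lemma integral_truncation (h : IsTestField Ω g g₀) {u : E n → ℝ} (hu : ContDiff ℝ 1 u) :
    ∫ x, truncation (u x) * (g₀ x + divergence g x) =
      ∫ x, u x * (truncationRatio (u x) * g₀ x +
        divergence (fun y => truncationSlope (u y) • g y) x) := by
  set a : ℝ → ℝ := fun t => truncation t - t * truncationSlope t with ha
  have haC : ContDiff ℝ 1 a := truncation_contDiff.sub (contDiff_id.mul truncationSlope_contDiff)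
  have had : ∀ t, HasDerivAt a (-(t * deriv truncationSlope t)) t := fun t => by
    have h1 := (truncation_hasDerivAt t).sub ((hasDerivAt_id t).mul
      (truncationSlope_contDiff.differentiable one_ne_zero t).hasDerivAt)
    refine h1.congr_deriv ?_
    simp
  have hG := h.truncation_smul hu
  have hau : ContDiff ℝ 1 fun x => a (u x) := haC.comp hu
  have hX : ContDiff ℝ 1 fun x => a (u x) • g x := hau.fun_smul h.contDiff
  have hXc : HasCompactSupport fun x => a (u x) • g x :=
    h.hasCompactSupport.mono fun x hx h0 => hx (by simp only [h0, smul_zero])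
  have hpt : ∀ x, truncation (u x) * (g₀ x + divergence g x) =
      u x * (truncationRatio (u x) * g₀ x + divergence (fun y => truncationSlope (u y) • g y) x) +
        divergence (fun y => a (u y) • g y) x := fun x => by
    have hux := (hu.differentiable one_ne_zero x).hasFDerivAt
    have hgx := h.contDiff.differentiable one_ne_zero x
    have hs := ((truncationSlope_contDiff.differentiable one_ne_zero (u x)).hasDerivAt).comp_hasFDerivAt
      x hux
    have hax := (had (u x)).comp_hasFDerivAt x hux
    have e1 := divergence_smul hs.differentiableAt hgx
    have e2 := divergence_smul hax.differentiableAt hgx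
    rw [hs.fderiv] at e1
    rw [hax.fderiv] at e2
    simp only [Function.comp_def, smul_apply, smul_eq_mul, mul_assoc,
      ← Finset.mul_sum] at e1 e2
    rw [e1, e2]
    simp only [ha]
    linear_combination (-g₀ x) * mul_truncationRatio (u x)
  simp only [hpt]
  rw [integral_add, integral_divergence_eq_zero hX hXc, add_zero]
  · exact (hu.continuous.mul hG.continuous_add).integrable_of_hasCompactSupport
      hG.hasCompactSupport_add.mul_left
  · exact (continuous_divergence hX).integrable_of_hasCompactSupport
      (hasCompactSupport_divergence hXc)

end IsTestField

end Capillary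

/-! ### Truncation does not increase the weighted area. -/

namespace Capillary

variable {n : ℕ}

/-- By Fubini, testing a mollification is averaging, with a probability weight, the tests of `V`
against translates of `ψ`. -/
lemma integral_convolution_mul_le {V ψ : E n → ℝ} (hV : Integrable V)
    (φ : ContDiffBump (0 : E n)) (hψ : Continuous ψ) {C A : ℝ} (hC : ∀ x, ‖ψ x‖ ≤ C)
    (hA : ∀ t ∈ Metric.ball (0 : E n) φ.rOut, ∫ y, V y * ψ (y + t) ≤ A) :
    ∫ x, (φ.normed volume ⋆[ContinuousLinearMap.lsmul ℝ ℝ, volume] V) x * ψ x ≤ A := by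
  have hI : Integrable (fun p : E n × E n => φ.normed volume p.2 * V (p.1 - p.2) * ψ p.1)
      (volume.prod volume) := by
    refine (Integrable.convolution_integrand (ContinuousLinearMap.lsmul ℝ ℝ) (f := φ.normed volume)
      (g := V) (μ := volume) (ν := volume) φ.integrable_normed hV).mul_bdd (c := C) ?_ ?_
    · exact (hψ.comp continuous_fst).aestronglyMeasurable
    · exact ae_of_all _ fun p => hC _
  calc ∫ x, (φ.normed volume ⋆[ContinuousLinearMap.lsmul ℝ ℝ, volume] V) x * ψ x
      = ∫ x, ∫ t, φ.normed volume t * V (x - t) * ψ x := by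
        refine integral_congr_ae (ae_of_all _ fun x => ?_)
        simp only [convolution_def, ContinuousLinearMap.lsmul_apply, smul_eq_mul, integral_mul_const]
    _ = ∫ t, ∫ x, φ.normed volume t * V (x - t) * ψ x := integral_integral_swap hI
    _ ≤ ∫ t, φ.normed volume t * A := by
        refine integral_mono hI.integral_prod_right (φ.integrable_normed.mul_const A) fun t => ?_
        simp only [mul_assoc, integral_const_mul]
        by_cases ht : t ∈ Metric.ball (0 : E n) φ.rOut
        · refine mul_le_mul_of_nonneg_left ?_ (φ.nonneg_normed t)
          rw [← integral_add_right_eq_self _ t]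
          simpa using hA t ht
        · have : φ.normed volume t = 0 := by
            rw [← Function.notMem_support, φ.support_normed_eq]; exact ht
          simp [this]
    _ = A := by rw [integral_mul_const, φ.integral_normed, one_mul]

variable {Ω : Set (E n)}

lemma IsTestField.integral_le_of_weightedArea_le {g : E n → E n} {g₀ v : E n → ℝ} {A : ℝ}
    (h : IsTestField Ω g g₀) (hA : weightedArea Ω v ≤ A) :
    ∫ x, v x * (g₀ x + divergence g x) ≤ A := by
  rw [← h.setIntegral_eq_integral, ← EReal.coe_le_coe_iff]
  refine le_trans ?_ hA
  exact le_iSup_of_le g <| le_iSup_of_le g₀ <| le_iSup_of_le h le_rfl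

lemma weightedArea_le_iff {v : E n → ℝ} {A : ℝ} : weightedArea Ω v ≤ A ↔
    ∀ g g₀, IsTestField Ω g g₀ → ∫ x in Ω, v x * (g₀ x + divergence g x) ≤ A := by
  simp only [weightedArea, iSup_le_iff, EReal.coe_le_coe_iff]

lemma weightedArea_congr {v w : E n → ℝ} (h : v =ᵐ[volume.restrict Ω] w) :
    weightedArea Ω v = weightedArea Ω w := by
  unfold weightedArea
  refine iSup_congr fun g => iSup_congr fun g₀ => iSup_congr fun _ => ?_
  have : (fun x => v x * (g₀ x + divergence g x)) =ᵐ[volume.restrict Ω]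
      fun x => w x * (g₀ x + divergence g x) := h.mono fun x hx => by simp only [hx]
  rw [integral_congr_ae this]

/-- Mollify `V`, move the truncation onto the test field, then move the mollification there as
translations. Small translations keep the supports inside `Ω`, so each test is bounded by the area
of `V` itself. -/
lemma integral_truncation_le {V g₀ : E n → ℝ} {g : E n → E n} {A : ℝ} (hΩ : IsOpen Ω)
    (hV : Integrable V) (hV0 : ∀ x, 0 ≤ V x) (hA : weightedArea Ω V ≤ A)
    (h : IsTestField Ω g g₀) : ∫ x, truncation (V x) * (g₀ x + divergence g x) ≤ A := by
  obtain ⟨r₁, hr₁, hg⟩ := IsCompact.exists_cthickening_subset_open h.hasCompactSupport hΩ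
    h.tsupport_subset
  obtain ⟨r₂, hr₂, hg₀⟩ := IsCompact.exists_cthickening_subset_open h.hasCompactSupport_last hΩ
    h.tsupport_last_subset
  obtain ⟨C, hC⟩ := h.exists_bound
  set r := min r₁ r₂ with hr
  have hr0 : 0 < r := lt_min hr₁ hr₂
  have hd : ∀ k : ℕ, 0 < r / (k + 1) := fun k => by positivity
  -- The outer radius is twice the inner one, which gives the constant `K = 2` in the almost
  -- everywhere convergence below.
  let φ : ℕ → ContDiffBump (0 : E n) := fun k =>
    ⟨r / (k + 1) / 2, r / (k + 1), half_pos (hd k), half_lt_self (hd k)⟩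
  have hφr : ∀ k, (φ k).rOut ≤ r := fun k => div_le_self hr0.le (by simp)
  set u : ℕ → E n → ℝ := fun k =>
    (φ k).normed volume ⋆[ContinuousLinearMap.lsmul ℝ ℝ, volume] V with hu
  have huC : ∀ k, ContDiff ℝ 1 (u k) := fun k =>
    (φ k).hasCompactSupport_normed.contDiff_convolution_left _ (φ k).contDiff_normed
      hV.locallyIntegrable
  have hu0 : ∀ k x, 0 ≤ u k x := fun k x =>
    integral_nonneg fun t => mul_nonneg ((φ k).nonneg_normed t) (hV0 _)
  have hlim : ∀ᵐ x, Tendsto (fun k => u k x) atTop (𝓝 (V x)) := by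
    refine ContDiffBump.ae_convolution_tendsto_right_of_locallyIntegrable (K := 2) ?_ ?_
      hV.locallyIntegrable
    · exact tendsto_const_div_atTop_nhds_zero_nat r |>.comp (tendsto_add_atTop_nat 1) |>.congr
        fun k => by simp [φ]
    · exact Eventually.of_forall fun k => by simp only [φ]; linarith
  have hle : ∀ k, ∫ x, truncation (u k x) * (g₀ x + divergence g x) ≤ A := by
    intro k
    -- The new field depends on `k`, but the bound `A` holds for all admissible fields.
    rw [h.integral_truncation (huC k)]
    have hG := h.truncation_smul (huC k)
    obtain ⟨C', hC'⟩ := hG.exists_bound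
    refine integral_convolution_mul_le hV (φ k) hG.continuous_add hC' fun t ht => ?_
    have ht' : t ∈ Metric.ball 0 r := Metric.ball_subset_ball (hφr k) ht
    have sg : tsupport (fun x => truncationSlope (u k x) • g x) ⊆ tsupport g :=
      closure_mono fun x hx h0 => hx (by simp only [h0, smul_zero])
    have sg₀ : tsupport (fun x => truncationRatio (u k x) * g₀ x) ⊆ tsupport g₀ :=
      closure_mono fun x hx h0 => hx (by simp only [h0, mul_zero])
    have hGt := hG.comp_add ht'
      ((Metric.cthickening_mono (min_le_left _ _) _).trans
        ((Metric.cthickening_subset_of_subset _ sg).trans hg))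
      ((Metric.cthickening_mono (min_le_right _ _) _).trans
        ((Metric.cthickening_subset_of_subset _ sg₀).trans hg₀))
    have := hGt.integral_le_of_weightedArea_le hA
    simpa only [divergence_comp_add (fun x => truncationSlope (u k x) • g x)] using this
  refine le_of_tendsto' (tendsto_integral_of_dominated_convergence
    (F := fun k x => truncation (u k x) * (g₀ x + divergence g x))
    (fun x => 2 * ‖g₀ x + divergence g x‖) ?_ ?_ ?_ ?_) hle
  · exact fun k => ((truncation_contDiff.continuous.comp (huC k).continuous).mul
      h.continuous_add).aestronglyMeasurable
  · exact (h.continuous_add.integrable_of_hasCompactSupport h.hasCompactSupport_add).norm.const_mul 2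
  · refine fun k => ae_of_all _ fun x => ?_
    rw [norm_mul, Real.norm_eq_abs, abs_of_nonneg (truncation_nonneg (hu0 k x))]
    exact mul_le_mul_of_nonneg_right (truncation_le_two _) (norm_nonneg _)
  · filter_upwards [hlim] with x hx
    exact ((truncation_contDiff.continuous.tendsto _).comp hx).mul_const _

/-- Mollification needs a function on the whole space. A jump across the boundary is harmless,
because test fields have compact support in `Ω`. -/
lemma exists_integrable_nonneg_extension {v : E n → ℝ} (hΩ : MeasurableSet Ω)
    (hv : IntegrableOn v Ω) (hv0 : ∀ᵐ x ∂(volume.restrict Ω), 0 ≤ v x) :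
    ∃ V : E n → ℝ, Integrable V ∧ (∀ x, 0 ≤ V x) ∧ v =ᵐ[volume.restrict Ω] V := by
  refine ⟨Ω.indicator fun x => max (v x) 0, ?_, ?_, ?_⟩
  · exact (integrable_indicator_iff hΩ).2 hv.pos_part
  · exact Set.indicator_nonneg fun x _ => le_max_right _ _
  · filter_upwards [hv0, ae_restrict_mem hΩ] with x hx hxΩ
    rw [Set.indicator_of_mem hxΩ, max_eq_left hx]

lemma weightedArea_truncation_le {v : E n → ℝ} {A : ℝ} (hΩ : IsOpen Ω) (hv : IntegrableOn v Ω)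
    (hv0 : ∀ᵐ x ∂(volume.restrict Ω), 0 ≤ v x) (hA : weightedArea Ω v ≤ A) :
    weightedArea Ω (fun x => truncation (v x)) ≤ A := by
  obtain ⟨V, hV, hV0, hvV⟩ := exists_integrable_nonneg_extension hΩ.measurableSet hv hv0
  have hT : (fun x => truncation (v x)) =ᵐ[volume.restrict Ω] fun x => truncation (V x) :=
    hvV.mono fun x hx => congrArg truncation hx
  rw [weightedArea_congr hT, weightedArea_le_iff]
  rw [weightedArea_congr hvV] at hA
  intro g g₀ h
  rw [h.setIntegral_eq_integral (fun x => truncation (V x))]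
  exact integral_truncation_le hΩ hV hV0 hA h

/-! ### Weighted area versus graph area, and membership in `BVPlus`. -/

lemma isTestField_zero : IsTestField Ω (0 : E n → E n) 0 := by
  have h1 : tsupport (0 : E n → E n) = ∅ := tsupport_eq_empty_iff.2 rfl
  have h2 : tsupport (0 : E n → ℝ) = ∅ := tsupport_eq_empty_iff.2 rfl
  exact ⟨contDiff_const, contDiff_const, .zero, .zero, by simp [h1], by simp [h2], by simp⟩

/-- The two areas differ only in the term with `g₀`; dropping it isolates the total variation common
to both. -/
lemma IsTestField.last_zero {g : E n → E n} {g₀ : E n → ℝ} (h : IsTestField Ω g g₀) :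
    IsTestField Ω g 0 :=
  ⟨h.contDiff, contDiff_const, h.hasCompactSupport, .zero, h.tsupport_subset,
    by simp [tsupport_eq_empty_iff.2], fun x => by
      have := h.sq_add_sq_le_one x
      simp only [Pi.zero_apply]
      nlinarith [sq_nonneg (g₀ x)]⟩

lemma IsTestField.abs_last_le_one {g : E n → E n} {g₀ : E n → ℝ} (h : IsTestField Ω g g₀)
    (x : E n) : |g₀ x| ≤ 1 := by
  rw [← sq_le_one_iff_abs_le_one]
  nlinarith [h.sq_add_sq_le_one x, sq_nonneg ‖g x‖]

lemma weightedArea_nonneg (v : E n → ℝ) : 0 ≤ weightedArea Ω v := by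
  refine le_iSup_of_le 0 <| le_iSup_of_le 0 <| le_iSup_of_le isTestField_zero ?_
  simp [divergence]

lemma IsTestField.integrableOn_last {g : E n → E n} {g₀ : E n → ℝ} (h : IsTestField Ω g g₀) :
    IntegrableOn g₀ Ω :=
  (h.contDiff_last.continuous.integrable_of_hasCompactSupport h.hasCompactSupport_last).integrableOn

lemma IsTestField.integrableOn_mul_divergence {g : E n → E n} {g₀ v : E n → ℝ}
    (h : IsTestField Ω g g₀) (hv : IntegrableOn v Ω) :
    IntegrableOn (fun x => v x * divergence g x) Ω := by
  obtain ⟨C, hC⟩ := (hasCompactSupport_divergence h.hasCompactSupport).exists_bound_of_continuous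
    (continuous_divergence h.contDiff)
  exact hv.mul_bdd (continuous_divergence h.contDiff).aestronglyMeasurable (ae_of_all _ hC)

lemma IsTestField.integrableOn_mul_last {g : E n → E n} {g₀ v : E n → ℝ}
    (h : IsTestField Ω g g₀) (hv : IntegrableOn v Ω) :
    IntegrableOn (fun x => v x * g₀ x) Ω :=
  hv.mul_bdd h.contDiff_last.continuous.aestronglyMeasurable (ae_of_all _ h.abs_last_le_one)

lemma graphArea_le {v : E n → ℝ} (hΩ : volume Ω ≠ ⊤) (hv : IntegrableOn v Ω)
    {A : ℝ} (hA : weightedArea Ω v ≤ A) : graphArea Ω v ≤ (volume.real Ω + A : ℝ) := by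
  simp only [graphArea, iSup_le_iff, EReal.coe_le_coe_iff]
  intro g g₀ h
  rw [integral_add h.integrableOn_last (h.integrableOn_mul_divergence hv)]
  have h1 : ∫ x in Ω, g₀ x ≤ volume.real Ω := by
    have := integral_mono_ae (μ := volume.restrict Ω) (g := fun _ => (1 : ℝ)) h.integrableOn_last
      (integrableOn_const hΩ) (ae_of_all _ fun x => (abs_le.1 (h.abs_last_le_one x)).2)
    simpa using this
  have h2 := weightedArea_le_iff.1 hA g 0 h.last_zero
  simp only [Pi.zero_apply, zero_add] at h2
  linarith

lemma weightedArea_lt_top {v : E n → ℝ} (hv : v ∈ BV Ω) : weightedArea Ω v < ⊤ := by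
  obtain ⟨hi, hG⟩ := hv
  obtain ⟨B, hB⟩ : ∃ B : ℝ, graphArea Ω v ≤ B := by
    refine ⟨(graphArea Ω v).toReal, EReal.le_coe_toReal hG.ne⟩
  refine lt_of_le_of_lt (b := (((∫ x in Ω, |v x|) + B : ℝ) : EReal)) ?_ (EReal.coe_lt_top _)
  rw [weightedArea_le_iff]
  intro g g₀ h
  simp only [mul_add]
  rw [integral_add (h.integrableOn_mul_last hi) (h.integrableOn_mul_divergence hi)]
  refine add_le_add ?_ ?_
  · refine integral_mono (h.integrableOn_mul_last hi) hi.abs fun x => ?_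
    refine (le_abs_self _).trans ?_
    rw [abs_mul]
    exact mul_le_of_le_one_right (abs_nonneg _) (h.abs_last_le_one x)
  · simp only [graphArea, iSup_le_iff, EReal.coe_le_coe_iff] at hB
    simpa using hB g 0 h.last_zero

lemma truncation_mem_BVPlus {v : E n → ℝ} (hΩ : IsOpen Ω) (hb : Bornology.IsBounded Ω)
    (hv : v ∈ BVPlus Ω) : (fun x => truncation (v x)) ∈ BVPlus Ω := by
  have hi : IntegrableOn (fun x => truncation (v x)) Ω := by
    refine Integrable.mono hv.1.1
      (truncation_contDiff.continuous.comp_aestronglyMeasurable hv.1.1.aestronglyMeasurable) ?_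
    filter_upwards [hv.2] with x hx
    rw [Real.norm_of_nonneg hx, Real.norm_of_nonneg (truncation_nonneg hx)]
    exact truncation_le_self _
  refine ⟨⟨hi, ?_⟩, hv.2.mono fun x => truncation_nonneg⟩
  have hA := EReal.le_coe_toReal (weightedArea_lt_top hv.1).ne
  exact (graphArea_le hb.measure_lt_top.ne hi
    (weightedArea_truncation_le hΩ hv.1.1 hv.2 hA)).trans_lt (EReal.coe_lt_top _)

lemma weightedArea_zero : weightedArea Ω (0 : E n → ℝ) = 0 :=
  le_antisymm (weightedArea_le_iff.2 fun g g₀ _ => by simp) (weightedArea_nonneg _)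

lemma zero_mem_BVPlus (hb : Bornology.IsBounded Ω) : (0 : E n → ℝ) ∈ BVPlus Ω :=
  ⟨⟨integrableOn_zero, (graphArea_le hb.measure_lt_top.ne integrableOn_zero
    (A := 0) weightedArea_zero.le).trans_lt (EReal.coe_lt_top _)⟩, by simp⟩

end Capillary

/-! ### Finite surface measure of a Lipschitz boundary. -/

namespace Capillary

variable {n : ℕ} {Ω : Set (E n)}

lemma eq_inner_of_mem_frontier {ν x₀ : E n} {r : ℝ} {L : NNReal} {φ : (ℝ ∙ ν)ᗮ → ℝ}
    (hΩ : IsOpen Ω) (hφ : LipschitzWith L φ)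
    (h : ∀ x ∈ Metric.ball x₀ r,
      x ∈ Ω ↔ φ ((ℝ ∙ ν)ᗮ.orthogonalProjectionOnto x) < inner ℝ ν x)
    {x : E n} (hx : x ∈ frontier Ω) (hxr : x ∈ Metric.ball x₀ r) :
    φ ((ℝ ∙ ν)ᗮ.orthogonalProjectionOnto x) = inner ℝ ν x := by
  rw [hΩ.frontier_eq] at hx
  refine le_antisymm ?_ (not_lt.1 fun hlt => hx.2 ((h x hxr).2 hlt))
  by_contra! hlt
  have hc : Continuous fun y => φ ((ℝ ∙ ν)ᗮ.orthogonalProjectionOnto y) :=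
    hφ.continuous.comp (ContinuousLinearMap.continuous _)
  have hn : ∀ᶠ y in 𝓝 x, inner ℝ ν y < φ ((ℝ ∙ ν)ᗮ.orthogonalProjectionOnto y) :=
    (continuous_const.inner continuous_id).continuousAt.eventually_lt hc.continuousAt hlt
  obtain ⟨y, hyΩ, hy, hyr⟩ := ((mem_closure_iff_frequently.1 hx.1).and_eventually
    (hn.and (Metric.isOpen_ball.mem_nhds hxr))).exists
  exact hy.not_gt ((h y hyr).1 hyΩ)

lemma lipschitzWith_graph {ν : E n} (hν : ‖ν‖ = 1) {L : NNReal} {φ : (ℝ ∙ ν)ᗮ → ℝ}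
    (hφ : LipschitzWith L φ) :
    LipschitzWith (1 + L) fun y : (ℝ ∙ ν)ᗮ => (y : E n) + φ y • ν := by
  refine LipschitzWith.add (LipschitzWith.subtype_val _) (LipschitzWith.of_dist_le_mul fun y z => ?_)
  rw [dist_eq_norm, ← sub_smul, norm_smul, hν, mul_one, ← dist_eq_norm]
  exact hφ.dist_le_mul y z

lemma orthogonalProjection_add_inner_smul {ν : E n} (hν : ‖ν‖ = 1) (x : E n) :
    ((ℝ ∙ ν)ᗮ.orthogonalProjectionOnto x : E n) + inner ℝ ν x • ν = x := by
  have h := (ℝ ∙ ν).starProjection_add_starProjection_orthogonal x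
  rw [Submodule.starProjection_unit_singleton ℝ hν] at h
  rw [add_comm]; exact h

/-- Locally the frontier lies in the Lipschitz image of a ball in a hyperplane, which has finite
measure; compactness globalises this. -/
lemma euclideanHausdorffMeasure_frontier_lt_top (hΩ : IsOpen Ω) (hb : Bornology.IsBounded Ω)
    (hl : HasLipschitzBoundary Ω) :
    Measure.euclideanHausdorffMeasure (n - 1) (frontier Ω) < ⊤ := by
  have hK : IsCompact (frontier Ω) := Metric.isCompact_of_isClosed_isBounded isClosed_frontier
    (hb.closure.subset frontier_subset_closure)
  refine hK.measure_lt_top_of_nhdsWithin fun x₀ hx₀ => ?_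
  obtain ⟨ν, r, L, φ, hν, hr, hφ, h⟩ := hl x₀ hx₀
  refine ⟨frontier Ω ∩ Metric.ball x₀ r,
    inter_mem_nhdsWithin _ (Metric.ball_mem_nhds _ hr), ?_⟩
  have hν0 : ν ≠ 0 := fun h0 => by simp [h0] at hν
  have hdim : Module.finrank ℝ (ℝ ∙ ν)ᗮ = n - 1 := by
    have h1 := (ℝ ∙ ν).finrank_add_finrank_orthogonal
    rw [finrank_span_singleton hν0, finrank_euclideanSpace_fin] at h1
    omega
  have hsub : frontier Ω ∩ Metric.ball x₀ r ⊆
      (fun y : (ℝ ∙ ν)ᗮ => (y : E n) + φ y • ν) '' Metric.closedBall 0 (‖x₀‖ + r) := by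
    rintro x ⟨hx, hxr⟩
    refine ⟨(ℝ ∙ ν)ᗮ.orthogonalProjectionOnto x, ?_, ?_⟩
    · rw [mem_closedBall_zero_iff]
      refine (Submodule.norm_orthogonalProjectionOnto_apply_le _ x).trans ?_
      have h1 := norm_le_norm_add_norm_sub' x x₀
      rw [Metric.mem_ball, dist_eq_norm] at hxr
      linarith
    · simp only [eq_inner_of_mem_frontier hΩ hφ h hx hxr]
      exact orthogonalProjection_add_inner_smul hν x
  have hfin : (Measure.hausdorffMeasure ((n - 1 : ℕ) : ℝ) : Measure (E n))
      (frontier Ω ∩ Metric.ball x₀ r) < ⊤ := by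
    refine (measure_mono hsub).trans_lt
      (((lipschitzWith_graph hν hφ).hausdorffMeasure_image_le (Nat.cast_nonneg _) _).trans_lt ?_)
    refine ENNReal.mul_lt_top (ENNReal.rpow_lt_top_of_nonneg (Nat.cast_nonneg _) (by simp)) ?_
    -- In the dimension of the hyperplane itself, Hausdorff measure is finite on compact sets.
    rw [← hdim]
    exact (isCompact_closedBall _ _).measure_lt_top
  rw [Measure.euclideanHausdorffMeasure_def, Measure.smul_apply, ENNReal.smul_def]
  exact ENNReal.mul_lt_top ENNReal.coe_lt_top hfin

end Capillary

/-! ### Potential energy, traces and the wetting integral. -/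

namespace Capillary

lemma integral_one_log (t : ℝ) : ∫ h in (1 : ℝ)..t, Real.log h = t * Real.log t - t + 1 := by
  rw [integral_log]; simp

lemma integral_one_log_nonneg {t : ℝ} (ht : 0 ≤ t) : 0 ≤ ∫ h in (1 : ℝ)..t, Real.log h := by
  rw [integral_one_log]
  rcases ht.eq_or_lt with rfl | ht
  · simp
  · have h := mul_le_mul_of_nonneg_left (Real.one_sub_inv_le_log_of_pos ht) ht.le
    rw [mul_sub, mul_inv_cancel₀ ht.ne'] at h
    linarith

/-- The logarithm is positive beyond `1`. This strictness is what finally excludes large values of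
`v`. -/
lemma integral_one_log_lt {s t : ℝ} (hs : 1 ≤ s) (hst : s < t) :
    ∫ h in (1 : ℝ)..s, Real.log h < ∫ h in (1 : ℝ)..t, Real.log h := by
  rw [← intervalIntegral.integral_add_adjacent_intervals
    (intervalIntegral.intervalIntegrable_log' (a := 1) (b := s))
    (intervalIntegral.intervalIntegrable_log' (a := s) (b := t)), lt_add_iff_pos_right]
  exact intervalIntegral.intervalIntegral_pos_of_pos_on intervalIntegral.intervalIntegrable_log'
    (fun h hh => Real.log_pos (hs.trans_lt hh.1)) hst

lemma integral_one_log_truncation_le (t : ℝ) :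
    ∫ h in (1 : ℝ)..truncation t, Real.log h ≤ ∫ h in (1 : ℝ)..t, Real.log h := by
  rcases le_total t 1 with ht | ht
  · rw [truncation_of_le_one ht]
  · rcases (truncation_le_self t).eq_or_lt with h | h
    · rw [h]
    · exact (integral_one_log_lt (one_le_truncation ht) h).le

section extIntegral

variable {α : Type*} [MeasurableSpace α] {μ : Measure α} {f g : α → EReal}

lemma extIntegral_mono (h : ∀ᵐ x ∂μ, f x ≤ g x) : extIntegral μ f ≤ extIntegral μ g := by
  refine EReal.sub_le_sub ?_ ?_ <;> rw [EReal.coe_ennreal_le_coe_ennreal_iff]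
  · exact lintegral_mono_ae (h.mono fun x hx => EReal.toENNReal_le_toENNReal hx)
  · exact lintegral_mono_ae (h.mono fun x hx =>
      EReal.toENNReal_le_toENNReal (EReal.neg_le_neg_iff.2 hx))

lemma extIntegral_of_nonneg (h : ∀ᵐ x ∂μ, 0 ≤ f x) :
    extIntegral μ f = ((∫⁻ x, (f x).toENNReal ∂μ : ENNReal) : EReal) := by
  have : ∫⁻ x, (-f x).toENNReal ∂μ = 0 := by
    rw [lintegral_congr_ae (g := fun _ => 0) (h.mono fun x hx =>
      EReal.toENNReal_of_nonpos (by simpa using hx)), lintegral_zero]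
  simp [extIntegral, this]

end extIntegral

variable {n : ℕ} {Ω : Set (E n)}

/-- The means are ordered at every radius, so the upper limits are ordered at every point, whether
or not the limits exist. -/
lemma trace_mono {v w : E n → ℝ} (hv : IntegrableOn v Ω) (hw : IntegrableOn w Ω)
    (h : ∀ᵐ x ∂(volume.restrict Ω), w x ≤ v x) (x : E n) : trace Ω w x ≤ trace Ω v x := by
  refine limsup_le_limsup (Eventually.of_forall fun r => ?_)
  simp only [EReal.coe_le_coe_iff, setAverage_eq]
  have hs : Metric.ball x r ∩ Ω ⊆ Ω := Set.inter_subset_right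
  refine smul_le_smul_of_nonneg_left ?_ (inv_nonneg.2 measureReal_nonneg)
  exact integral_mono_ae (hw.mono_set hs) (hv.mono_set hs) (ae_restrict_of_ae_restrict_of_subset hs h)

lemma trace_zero (x : E n) : trace Ω (0 : E n → ℝ) x = 0 := by
  simp [trace]

lemma trace_nonneg {v : E n → ℝ} (hv : v ∈ BVPlus Ω) (x : E n) : 0 ≤ trace Ω v x := by
  rw [← trace_zero (Ω := Ω) x]
  exact trace_mono hv.1.1 integrableOn_zero hv.2 x

lemma wettingIntegral_anti {β v w : E n → ℝ} (hβ : ∀ᵐ x ∂(surfaceMeasure Ω), 0 ≤ β x)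
    (h : ∀ x, trace Ω w x ≤ trace Ω v x) : wettingIntegral Ω β v ≤ wettingIntegral Ω β w :=
  extIntegral_mono <| hβ.mono fun x hx =>
    mul_le_mul_of_nonneg_left (EReal.sub_le_sub le_rfl (h x)) (EReal.coe_nonneg.2 hx)

lemma wettingIntegral_lt_top {β v : E n → ℝ} (hΩ : IsOpen Ω) (hb : Bornology.IsBounded Ω)
    (hl : HasLipschitzBoundary Ω) (hβ : MemLp β ⊤ (surfaceMeasure Ω))
    (hβ0 : ∀ᵐ x ∂(surfaceMeasure Ω), 0 ≤ β x) (hv : v ∈ BVPlus Ω) :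
    wettingIntegral Ω β v < ⊤ := by
  set C := (eLpNormEssSup β (surfaceMeasure Ω)).toReal with hC
  have hβC : ∀ᵐ x ∂(surfaceMeasure Ω), β x ≤ C := by
    have hfin : eLpNormEssSup β (surfaceMeasure Ω) ≠ ⊤ := by
      simpa using hβ.2.ne
    filter_upwards [enorm_ae_le_eLpNormEssSup β (surfaceMeasure Ω)] with x hx
    have := ENNReal.toReal_mono hfin hx
    rw [toReal_enorm] at this
    exact (le_abs_self _).trans this
  have hC0 : (0 : EReal) ≤ (C : EReal) := EReal.coe_nonneg.2 ENNReal.toReal_nonneg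
  have hle : wettingIntegral Ω β v ≤ extIntegral (surfaceMeasure Ω) fun _ => (C : EReal) := by
    refine extIntegral_mono ?_
    filter_upwards [hβ0, hβC] with x h0 h1
    calc (β x : EReal) * (1 - trace Ω v x) ≤ β x * (1 - 0) :=
          mul_le_mul_of_nonneg_left (EReal.sub_le_sub le_rfl (trace_nonneg hv x))
            (EReal.coe_nonneg.2 h0)
      _ = β x := by simp
      _ ≤ C := EReal.coe_le_coe_iff.2 h1
  refine hle.trans_lt ?_
  rw [extIntegral_of_nonneg (ae_of_all _ fun _ => hC0), lintegral_const, lt_top_iff_ne_top, Ne,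
    EReal.coe_ennreal_eq_top_iff, surfaceMeasure, Measure.restrict_apply_univ]
  exact ENNReal.mul_ne_top (by simp)
    (euclideanHausdorffMeasure_frontier_lt_top hΩ hb hl).ne

lemma potentialEnergy_eq {v : E n → ℝ} (hv : v ∈ BVPlus Ω) :
    potentialEnergy Ω v =
      ((∫⁻ x in Ω, ENNReal.ofReal (∫ h in (1 : ℝ)..(v x), Real.log h) : ENNReal) : EReal) := by
  rw [potentialEnergy, extIntegral_of_nonneg (hv.2.mono fun x hx =>
    EReal.coe_nonneg.2 (integral_one_log_nonneg hx))]
  simp only [EReal.real_coe_toENNReal]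

/-- At `0` the area vanishes, the potential density is `1` on the bounded set `Ω`, and the wetting
integral is nonnegative. -/
lemma J₁_zero_lt_top {β : E n → ℝ} (hb : Bornology.IsBounded Ω)
    (hβ0 : ∀ᵐ x ∂(surfaceMeasure Ω), 0 ≤ β x) : J₁ Ω β 0 < ⊤ := by
  have hp : potentialEnergy Ω (0 : E n → ℝ) < ⊤ := by
    rw [potentialEnergy_eq (zero_mem_BVPlus hb)]
    simp [lt_top_iff_ne_top, hb.measure_lt_top.ne]
  have hw : 0 ≤ wettingIntegral Ω β 0 := by
    have h0 : ∀ᵐ x ∂(surfaceMeasure Ω), (0 : EReal) ≤ β x * (1 - trace Ω 0 x) := by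
      filter_upwards [hβ0] with x hx
      simpa [trace_zero] using hx
    rw [wettingIntegral, extIntegral_of_nonneg h0]
    exact EReal.coe_ennreal_nonneg _
  rw [J₁, weightedArea_zero, zero_add]
  exact (EReal.sub_le_sub le_rfl hw).trans_lt (by simpa using hp)

end Capillary

/-! ### Comparison of the minimiser with its truncation. -/

open Capillary in
theorem mainTheorem5 {n : ℕ} (Ω : Set (Capillary.E n))
    (hΩ_open : IsOpen Ω) (hΩ_bounded : Bornology.IsBounded Ω)
    (hΩ_lipschitz : Capillary.HasLipschitzBoundary Ω)
    (β : Capillary.E n → ℝ)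
    (hβ : MemLp β ⊤ (Capillary.surfaceMeasure Ω))
    (hβ_nonneg : ∀ᵐ x ∂(Capillary.surfaceMeasure Ω), 0 ≤ β x)
    (v : Capillary.E n → ℝ) (hv : v ∈ Capillary.BVPlus Ω)
    (hv_min : IsMinOn (Capillary.J₁ Ω β) (Capillary.BVPlus Ω) v) :
    ∃ K : ℝ, ∀ᵐ x ∂(volume.restrict Ω), v x ≤ K := by
  set w : E n → ℝ := fun x => truncation (v x) with hw_def
  have hw : w ∈ BVPlus Ω := truncation_mem_BVPlus hΩ_open hΩ_bounded hv
  have hJ : J₁ Ω β v < ⊤ :=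
    (isMinOn_iff.1 hv_min 0 (zero_mem_BVPlus hΩ_bounded)).trans_lt
      (J₁_zero_lt_top hΩ_bounded hβ_nonneg)
  have hJw : J₁ Ω β v ≤ J₁ Ω β w := isMinOn_iff.1 hv_min w hw
  have hwet : wettingIntegral Ω β v ≤ wettingIntegral Ω β w :=
    wettingIntegral_anti hβ_nonneg
      (trace_mono hv.1.1 hw.1.1 (ae_of_all _ fun x => truncation_le_self _))
  have hwet_v := wettingIntegral_lt_top hΩ_open hΩ_bounded hΩ_lipschitz hβ hβ_nonneg hv
  have hwet_w := wettingIntegral_lt_top hΩ_open hΩ_bounded hΩ_lipschitz hβ hβ_nonneg hw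
  have harea : weightedArea Ω w ≤ weightedArea Ω v := by
    have htop := weightedArea_lt_top hv.1
    have hA := weightedArea_truncation_le hΩ_open hv.1.1 hv.2 (EReal.le_coe_toReal htop.ne)
    rwa [EReal.coe_toReal htop.ne
      ((EReal.bot_lt_zero.trans_le (weightedArea_nonneg v)).ne')] at hA
  have harea_v := weightedArea_lt_top hv.1
  have harea0 := weightedArea_nonneg (Ω := Ω) w
  simp only [J₁, potentialEnergy_eq hv, potentialEnergy_eq hw] at hJ hJw
  set P := ∫⁻ x in Ω, ENNReal.ofReal (∫ h in (1 : ℝ)..(v x), Real.log h) with hP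
  set P' := ∫⁻ x in Ω, ENNReal.ofReal (∫ h in (1 : ℝ)..(w x), Real.log h) with hP'
  have hP'P : P' ≤ P := lintegral_mono fun x =>
    ENNReal.ofReal_le_ofReal (integral_one_log_truncation_le _)
  have hareav_bot : weightedArea Ω v ≠ ⊥ := (EReal.bot_lt_zero.trans_le (harea0.trans harea)).ne'
  have hareaw_bot : weightedArea Ω w ≠ ⊥ := (EReal.bot_lt_zero.trans_le harea0).ne'
  generalize weightedArea Ω v = a at *
  generalize weightedArea Ω w = a' at *
  generalize wettingIntegral Ω β v = b at *
  generalize wettingIntegral Ω β w = b' at *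
  lift a to ℝ using ⟨harea_v.ne, hareav_bot⟩
  lift a' to ℝ using ⟨(harea.trans_lt harea_v).ne, hareaw_bot⟩
  -- A wetting integral equal to `⊥` would make the energy of `v` infinite.
  have hb_bot : b ≠ ⊥ := by
    rintro rfl
    rw [sub_eq_add_neg, EReal.neg_bot, EReal.add_top_of_ne_bot] at hJ
    · exact lt_irrefl _ hJ
    · simp [EReal.add_eq_bot_iff]
  lift b to ℝ using ⟨hwet_v.ne, hb_bot⟩
  lift b' to ℝ using ⟨hwet_w.ne, fun h => by simp [h] at hwet⟩
  have hP_top : P ≠ ⊤ := by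
    intro h
    rw [h, EReal.coe_ennreal_top, EReal.coe_add_top, EReal.top_sub_coe] at hJ
    exact lt_irrefl _ hJ
  have hPP' : P ≤ P' := by
    have hP'_top : P' ≠ ⊤ := ne_top_of_le_ne_top hP_top hP'P
    rw [← ENNReal.toReal_le_toReal hP_top hP'_top]
    rw [← EReal.coe_ennreal_toReal hP_top] at hJw
    rw [← EReal.coe_ennreal_toReal hP'_top] at hJw
    norm_cast at hJw harea hwet
    linarith
  have hmeas : AEMeasurable (fun x => ENNReal.ofReal (∫ h in (1 : ℝ)..(v x), Real.log h))
      (volume.restrict Ω) := by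
    simp only [integral_one_log]
    have := hv.1.1.aemeasurable
    fun_prop
  -- Pointwise ordered densities with equal finite integrals coincide almost everywhere.
  have heq := ae_eq_of_ae_le_of_lintegral_le (ae_of_all _ fun x =>
    ENNReal.ofReal_le_ofReal (integral_one_log_truncation_le (v x)))
    (ne_top_of_le_ne_top hP_top hP'P) hmeas hPP'
  -- Above `2` the truncation is strictly below the identity and at least `1`, so the densities
  -- would differ.
  refine ⟨2, ?_⟩
  filter_upwards [heq, hv.2, hw.2] with x hx h0 h0'
  by_contra! h2
  rw [ENNReal.ofReal_eq_ofReal_iff (integral_one_log_nonneg h0') (integral_one_log_nonneg h0)] at hx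
  exact (integral_one_log_lt (one_le_truncation (by linarith)) (truncation_lt_self h2)).ne hx
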